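/- Let $N\ge 1$, $\tau>0$, $1<q<\infty$, and let $\mathbb M_{N,N}$ be the space of complex $N\times N$ matrices with the Frobenius inner product. For $a\in\mathbb C^{2N-1}$, indexed by $0\le l\le 2N-2$, let $\Lambda a$ be the Hankel matrix $(\Lambda a)_{j,k}=a_{j+k}$, $0\le j,k\le N-1$; let $(\Lambda^*A)_l=\sum_{j+k=l}A_{j,k}$ and let $\beta_l=\#\{(j,k):0\le j,k\le N-1,\ j+k=l\}$. Let $\mathcal H=\Lambda(\mathbb C^{2N-1})$ be the space of Hankel matrices, and let $\mathcal P_{\mathcal H},\mathcal P_{\mathcal H^\perp}$ be the orthogonal projections onto $\mathcal H$ and $\mathcal H^\perp$. Let $\sigma_1(A)\ge\dots\ge\sigma_N(A)\ge0$ denote the singular values of $A$, and put $$\mathcal R_\tau(A)=\sum_{j=1}^N\Big(\tau^2-\big(\max(\tau-\sigma_j(A),0)\big)^2\Big),\qquad s_{\tau,q}(\sigma)=\max\big(\min(\sigma,\tau),\sigma/q\big).$$ For $s:[0,\infty)\to\mathbb R$ with $s(0)=0$ and a singular value decomposition $A=U\,\mathrm{diag}(\sigma_j(A))\,V^*$ let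 $\mathfrak S_s(A)=U\,\mathrm{diag}(s(\sigma_j(A)))\,V^*$. Let $\mu_l>0$ for $0\le l\le 2N-2$, let $f\in\mathbb C^{2N-1}$, and assume $q\ge\max_l \mu_l/\beta_l$. With all products and quotients of sequences taken pointwise, set $$F=\Lambda\Big(\frac{f\mu}{q\beta}\Big),\qquad \mathsf U(F,A)=F+A-\Lambda\Big(\frac{\mu}{q\beta^2}\Lambda^*(A)\Big),$$ and let $(W',A')=\mathfrak B_{\mathrm{weight}}(W,A)$ be defined for $W,A\in\mathbb M_{N,N}$ by $$W'=\mathfrak S_{s_{\tau,q}}\big(q\,\mathsf U(F,A)+\mathcal P_{\mathcal H^\perp}(W)\big),\qquad A'=\frac1{q-1}\big(q\,\mathsf U(F,A)-\mathcal P_{\mathcal H}(W')\big).$$ Consider the functional $$J(a)=\mathcal R_\tau(\Lambda a)+\sum_l\mu_l|a_l-f_l|^2,\qquad a\in\mathbb C^{2N-1},$$ and call $a^\circ$ a stationary point of $J$ if $0$ belongs to the (Fréchet) subdifferential of $J$ at $a^\circ$, where $\mathbb C^{2N-1}$ is regarded as a real vector space, that is, if $\liminf_{a\to a^\circ,\,a\neq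 a^\circ}\frac{J(a)-J(a^\circ)}{\|a-a^\circ\|}\ge0$. Then, for every $A^\circ\in\mathbb M_{N,N}$, there exists $W^\circ\in\mathbb M_{N,N}$ such that $(W^\circ,A^\circ)$ is a fixed point of $\mathfrak B_{\mathrm{weight}}$ if and only if $A^\circ=\Lambda(a^\circ)$ for some stationary point $a^\circ$ of $J$. Moreover, $J$ is convex if $\min_l\mu_l/\beta_l\ge1$, and strictly convex if $\min_l\mu_l/\beta_l>1$. -/

import Mathlib

namespace HankelApprox

open Matrix

noncomputable section

/-! ### Singular values and the singular value functional calculus -/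

/-- The `j`-th singular value `σ_j(A)` (in decreasing order) of a complex `N × N` matrix. -/
def sv {N : ℕ} (A : Matrix (Fin N) (Fin N) ℂ) (j : Fin N) : ℝ :=
  (Matrix.toEuclideanLin A).singularValues j

/-- `(U, V)` is a pair of unitary matrices with `A = U diag(σ_j(A)) V*`. -/
def IsSVD {N : ℕ} (A : Matrix (Fin N) (Fin N) ℂ)
    (UV : Matrix (Fin N) (Fin N) ℂ × Matrix (Fin N) (Fin N) ℂ) : Prop :=
  UV.1 ∈ Matrix.unitaryGroup (Fin N) ℂ ∧ UV.2 ∈ Matrix.unitaryGroup (Fin N) ℂ ∧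
    A = UV.1 * Matrix.diagonal (fun j => (sv A j : ℂ)) * UV.2ᴴ

/-- Every complex square matrix has a singular value decomposition. -/
theorem exists_isSVD {N : ℕ} (A : Matrix (Fin N) (Fin N) ℂ) : ∃ UV, IsSVD A UV := by
  set T := Matrix.toEuclideanLin A with hT
  have hn : Module.finrank ℂ (EuclideanSpace ℂ (Fin N)) = N := by simp
  have hS := T.isSymmetric_adjoint_comp_self
  set v := hS.eigenvectorBasis hn with hv
  have hin : ∀ i j, inner ℂ (T (v i)) (T (v j)) =
      ((sv A j : ℂ)) ^ 2 * (if i = j then 1 else 0) := by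
    intro i j
    rw [← LinearMap.adjoint_inner_right, ← LinearMap.comp_apply, hv,
      hS.apply_eigenvectorBasis, inner_smul_right, ← hv, orthonormal_iff_ite.mp v.orthonormal]
    have h := T.sq_singularValues_fin hn j
    congr 1
    simp only [sv]
    rw [← hT]
    rw [← h]
    push_cast
    rfl
  have hz : ∀ j, sv A j = 0 → T (v j) = 0 := by
    intro j hj
    have := hin j j
    rw [hj] at this
    simpa using this
  let w : Fin N → EuclideanSpace ℂ (Fin N) := fun j => ((sv A j : ℂ))⁻¹ • T (v j)
  have hw : Orthonormal ℂ (({j | sv A j ≠ 0} : Set (Fin N)).domRestrict w) := by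
    rw [orthonormal_iff_ite]
    rintro ⟨i, hi⟩ ⟨j, hj⟩
    have hi' : (sv A i : ℂ) ≠ 0 := by exact_mod_cast hi
    have hj' : (sv A j : ℂ) ≠ 0 := by exact_mod_cast hj
    change inner ℂ ((sv A i : ℂ)⁻¹ • T (v i)) ((sv A j : ℂ)⁻¹ • T (v j)) = _
    simp only [inner_smul_left, inner_smul_right, hin, Subtype.mk.injEq]
    by_cases hij : i = j
    · subst hij
      simp
      field_simp
    · simp [hij]
  obtain ⟨u, hu⟩ := hw.exists_orthonormalBasis_extension_of_card_eq (by simp)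
  have huv : ∀ j, T (v j) = (sv A j : ℂ) • u j := by
    intro j
    by_cases hj : sv A j = 0
    · rw [hz j hj, hj]; simp
    · have hj' : (sv A j : ℂ) ≠ 0 := by exact_mod_cast hj
      rw [hu j hj, smul_inv_smul₀ hj']
  set b := EuclideanSpace.basisFun (Fin N) ℂ with hb
  have hVu := b.toMatrix_orthonormalBasis_mem_unitary v
  refine ⟨(b.toBasis.toMatrix u, b.toBasis.toMatrix v),
    b.toMatrix_orthonormalBasis_mem_unitary u, hVu, ?_⟩
  have key : A * b.toBasis.toMatrix v =
      b.toBasis.toMatrix u * Matrix.diagonal (fun j => (sv A j : ℂ)) := by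
    ext i j
    have h := congrArg (fun x : EuclideanSpace ℂ (Fin N) => x i) (huv j)
    simp only [hT, Matrix.toLpLin_apply, Matrix.mulVec, dotProduct,
      PiLp.smul_apply, smul_eq_mul] at h
    rw [Matrix.mul_diagonal, Matrix.mul_apply]
    simpa [Module.Basis.toMatrix_apply, hb, mul_comm] using h
  have h2 : b.toBasis.toMatrix v * (b.toBasis.toMatrix v)ᴴ = 1 := by
    simpa [Matrix.star_eq_conjTranspose] using Matrix.mem_unitaryGroup_iff.mp hVu
  simp only
  rw [← key, Matrix.mul_assoc, h2, Matrix.mul_one]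

/-- The singular value functional calculus: `𝔖_f(A) = U diag(f(σ_j(A))) V*`, where
`A = U diag(σ_j(A)) V*` is a singular value decomposition.  For `f 0 = 0` the choice of the
decomposition is irrelevant, see `svCalc_eq`. -/
def svCalc {N : ℕ} (f : ℝ → ℝ) (A : Matrix (Fin N) (Fin N) ℂ) : Matrix (Fin N) (Fin N) ℂ :=
  (exists_isSVD A).choose.1 * Matrix.diagonal (fun j => (f (sv A j) : ℂ)) *
    ((exists_isSVD A).choose.2)ᴴ

/-- Two decompositions of the same matrix give the same value of the functional calculus. -/
theorem svCalc_aux {N : ℕ} {f : ℝ → ℝ} (hf : f 0 = 0) {A U V U' V' : Matrix (Fin N) (Fin N) ℂ}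
    {s s' : Fin N → ℝ} (hs : ∀ j, 0 ≤ s j) (hs' : ∀ j, 0 ≤ s' j)
    (hU : U ∈ Matrix.unitaryGroup (Fin N) ℂ) (hV : V ∈ Matrix.unitaryGroup (Fin N) ℂ)
    (hU' : U' ∈ Matrix.unitaryGroup (Fin N) ℂ) (hV' : V' ∈ Matrix.unitaryGroup (Fin N) ℂ)
    (h : A = U * Matrix.diagonal (fun j => (s j : ℂ)) * Vᴴ)
    (h' : A = U' * Matrix.diagonal (fun j => (s' j : ℂ)) * V'ᴴ) :
    U * Matrix.diagonal (fun j => (f (s j) : ℂ)) * Vᴴ =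
      U' * Matrix.diagonal (fun j => (f (s' j) : ℂ)) * V'ᴴ := by
  classical
  -- a polynomial `p` with `s * p (s ^ 2) = f s` at all the values involved
  let S : Finset ℝ := Finset.univ.image s ∪ Finset.univ.image s'
  let p : Polynomial ℂ := Lagrange.interpolate (S.image fun x => ((x ^ 2 : ℝ) : ℂ)) id
    (fun z => ((f (Real.sqrt z.re) / Real.sqrt z.re : ℝ) : ℂ))
  have hp : ∀ x ∈ S, 0 ≤ x → (x : ℂ) * p.eval ((x : ℂ) ^ 2) = (f x : ℂ) := by
    intro x hx h0
    have : p.eval (((x ^ 2 : ℝ) : ℂ)) = ((f x / x : ℝ) : ℂ) := by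
      have := Lagrange.eval_interpolate_at_node
        (s := S.image fun x => ((x ^ 2 : ℝ) : ℂ)) (v := id)
        (fun z => ((f (Real.sqrt z.re) / Real.sqrt z.re : ℝ) : ℂ))
        (Set.injOn_id _) (Finset.mem_image_of_mem (fun x : ℝ => ((x ^ 2 : ℝ) : ℂ)) hx)
      simp only [id, Complex.ofReal_re, Real.sqrt_sq h0] at this
      exact this
    rw [← Complex.ofReal_pow, this, ← Complex.ofReal_mul]
    by_cases hx0 : x = 0
    · subst hx0; simp [hf]
    · rw [mul_div_cancel₀ _ hx0]
  have main : ∀ (U V : Matrix (Fin N) (Fin N) ℂ) (s : Fin N → ℝ), (∀ j, 0 ≤ s j) →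
      (∀ j, s j ∈ S) → U ∈ Matrix.unitaryGroup (Fin N) ℂ → V ∈ Matrix.unitaryGroup (Fin N) ℂ →
      A = U * Matrix.diagonal (fun j => (s j : ℂ)) * Vᴴ →
      U * Matrix.diagonal (fun j => (f (s j) : ℂ)) * Vᴴ = A * Polynomial.aeval (Aᴴ * A) p := by
    intro U V s hs hsS hU hV h
    have hUU : Uᴴ * U = 1 := by
      simpa [Matrix.star_eq_conjTranspose] using Matrix.mem_unitaryGroup_iff'.mp hU
    have hVV : Vᴴ * V = 1 := by
      simpa [Matrix.star_eq_conjTranspose] using Matrix.mem_unitaryGroup_iff'.mp hV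
    have hVV' : V * Vᴴ = 1 := by
      simpa [Matrix.star_eq_conjTranspose] using Matrix.mem_unitaryGroup_iff.mp hV
    have hAA : Aᴴ * A = V * Matrix.diagonal (fun j => (s j : ℂ) ^ 2) * Vᴴ := by
      rw [h]
      simp only [Matrix.conjTranspose_mul, Matrix.conjTranspose_conjTranspose,
        Matrix.diagonal_conjTranspose]
      have : ∀ D E : Matrix (Fin N) (Fin N) ℂ,
          V * (D * Uᴴ) * (U * E * Vᴴ) = V * (D * (Uᴴ * U) * E) * Vᴴ := by
        intro D E; simp only [Matrix.mul_assoc]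
      rw [this, hUU, Matrix.mul_one, Matrix.diagonal_mul_diagonal]
      congr 3
      ext j
      simp [sq]
    have hpow : ∀ (D : Fin N → ℂ) (k : ℕ),
        (V * Matrix.diagonal D * Vᴴ) ^ k = V * Matrix.diagonal (fun j => D j ^ k) * Vᴴ := by
      intro D k
      induction k with
      | zero => simp [hVV']
      | succ k ih =>
        rw [pow_succ, ih]
        have : ∀ X Y : Matrix (Fin N) (Fin N) ℂ,
            V * X * Vᴴ * (V * Y * Vᴴ) = V * (X * (Vᴴ * V) * Y) * Vᴴ := by
          intro X Y; simp only [Matrix.mul_assoc]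
        rw [this, hVV, Matrix.mul_one, Matrix.diagonal_mul_diagonal]
        simp [pow_succ]
    have hpol : ∀ (r : Polynomial ℂ) (D : Fin N → ℂ),
        Polynomial.aeval (V * Matrix.diagonal D * Vᴴ) r =
          V * Matrix.diagonal (fun j => r.eval (D j)) * Vᴴ := by
      intro r D
      induction r using Polynomial.induction_on' with
      | add a b ha hb =>
        rw [map_add, ha, hb, ← Matrix.add_mul, ← Matrix.mul_add, Matrix.diagonal_add]
        simp
      | monomial k c =>
        rw [Polynomial.aeval_monomial, hpow, ← Algebra.smul_def]
        simp only [Polynomial.eval_monomial]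
        rw [← Matrix.smul_mul, ← Matrix.mul_smul, ← Matrix.diagonal_smul]
        rfl
    rw [hAA, hpol]
    nth_rewrite 1 [h]
    have : ∀ X Y : Matrix (Fin N) (Fin N) ℂ,
        U * X * Vᴴ * (V * Y * Vᴴ) = U * (X * (Vᴴ * V) * Y) * Vᴴ := by
      intro X Y; simp only [Matrix.mul_assoc]
    rw [this, hVV, Matrix.mul_one, Matrix.diagonal_mul_diagonal]
    congr 3
    ext j
    exact (hp (s j) (hsS j) (hs j)).symm
  rw [main U V s hs (by simp [S]) hU hV h, main U' V' s' hs' (by simp [S]) hU' hV' h']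

/-- `svCalc` is independent of the decomposition: if `A = U diag(s) V*` with `U, V` unitary and
`s ≥ 0`, then `𝔖_f(A) = U diag(f(s)) V*`, for every `f` with `f 0 = 0`. -/
theorem svCalc_eq {N : ℕ} {f : ℝ → ℝ} (hf : f 0 = 0) {A U V : Matrix (Fin N) (Fin N) ℂ}
    {s : Fin N → ℝ} (hs : ∀ j, 0 ≤ s j) (hU : U ∈ Matrix.unitaryGroup (Fin N) ℂ)
    (hV : V ∈ Matrix.unitaryGroup (Fin N) ℂ)
    (h : A = U * Matrix.diagonal (fun j => (s j : ℂ)) * Vᴴ) :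
    svCalc f A = U * Matrix.diagonal (fun j => (f (s j) : ℂ)) * Vᴴ := by
  have hc := (exists_isSVD A).choose_spec
  exact svCalc_aux hf (fun j => LinearMap.singularValues_nonneg _ _) hs hc.1 hc.2.1 hU hV hc.2.2 h

/-- The function `s_{τ,q}(σ) = max (min (σ, τ), σ / q)`. -/
def sFun (τ q σ : ℝ) : ℝ := max (min σ τ) (σ / q)

/-- The penalty `R_τ(A) = ∑_j (τ² - max(τ - σ_j(A), 0)²)`. -/
def rankPenalty {N : ℕ} (τ : ℝ) (A : Matrix (Fin N) (Fin N) ℂ) : ℝ :=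
  ∑ j : Fin N, (τ ^ 2 - (max (τ - sv A j) 0) ^ 2)

/-! ### Hankel matrices -/

/-- `Λ : ℂ^{2N-1} → M_{N,N}`, `(Λ a)_{j,k} = a_{j+k}` (all indices start at `0`). -/
def hankel (N : ℕ) : (Fin (2 * N - 1) → ℂ) →ₗ[ℂ] Matrix (Fin N) (Fin N) ℂ where
  toFun a := Matrix.of fun j k => a ⟨j + k, by omega⟩
  map_add' a b := by ext j k; simp
  map_smul' c a := by ext j k; simp

/-- `Λ*`, `(Λ* A)_l = ∑_{j+k=l} A_{j,k}`. -/
def hankelAdj {N : ℕ} (A : Matrix (Fin N) (Fin N) ℂ) (l : Fin (2 * N - 1)) : ℂ :=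
  ∑ j : Fin N, ∑ k : Fin N, if (j : ℕ) + k = l then A j k else 0

/-- `β_l = ∑_{j+k=l} 1`, the number of entries on the `l`-th anti-diagonal. -/
def antidiagCount (N : ℕ) (l : Fin (2 * N - 1)) : ℝ :=
  ∑ j : Fin N, ∑ k : Fin N, if (j : ℕ) + k = l then 1 else 0

/-- The subspace `H` of Hankel matrices. -/
def hankelSpace (N : ℕ) : Submodule ℂ (Matrix (Fin N) (Fin N) ℂ) := LinearMap.range (hankel N)

/-- The identification of `M_{N,N}`, with the Frobenius norm and inner product, with the
Euclidean space of the families of its entries. -/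
def toFrobenius (N : ℕ) :
    Matrix (Fin N) (Fin N) ℂ ≃ₗ[ℂ] EuclideanSpace ℂ (Fin N × Fin N) :=
  (Matrix.ofLinearEquiv ℂ).symm ≪≫ₗ (LinearEquiv.curry ℂ ℂ (Fin N) (Fin N)).symm ≪≫ₗ
    (WithLp.linearEquiv 2 ℂ (Fin N × Fin N → ℂ)).symm

/-- The orthogonal projection `P_H`, with respect to the Frobenius inner product, onto the
subspace of Hankel matrices. -/
def projHankel {N : ℕ} (A : Matrix (Fin N) (Fin N) ℂ) : Matrix (Fin N) (Fin N) ℂ :=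
  (toFrobenius N).symm
    (((hankelSpace N).map (toFrobenius N).toLinearMap).starProjection (toFrobenius N A))

/-- The orthogonal projection `P_{H^⊥}`, with respect to the Frobenius inner product, onto the
orthogonal complement of the subspace of Hankel matrices. -/
def projHankelPerp {N : ℕ} (A : Matrix (Fin N) (Fin N) ℂ) : Matrix (Fin N) (Fin N) ℂ :=
  (toFrobenius N).symm
    (((hankelSpace N).map (toFrobenius N).toLinearMap)ᗮ.starProjection (toFrobenius N A))

/-! ### The weighted fixed-point map and the objective functional -/

/-- `F = Λ(f μ / (q β))`. -/
def weightedData {N : ℕ} (μ : Fin (2 * N - 1) → ℝ) (f : Fin (2 * N - 1) → ℂ) (q : ℝ) :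
    Matrix (Fin N) (Fin N) ℂ :=
  hankel N fun l => f l * (μ l : ℂ) / ((q : ℂ) * (antidiagCount N l : ℂ))

/-- `U(F, A) = F + A - Λ(μ / (q β²) Λ*(A))`. -/
def weightedU {N : ℕ} (μ : Fin (2 * N - 1) → ℝ) (q : ℝ) (F A : Matrix (Fin N) (Fin N) ℂ) :
    Matrix (Fin N) (Fin N) ℂ :=
  F + A - hankel N fun l => (μ l : ℂ) / ((q : ℂ) * (antidiagCount N l : ℂ) ^ 2) * hankelAdj A l

/-- The map `B_weight`, `(W, A) ↦ (W', A')` with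
`W' = 𝔖_{s_{τ,q}}(q U(F, A) + P_{H^⊥}(W))` and `A' = (q U(F, A) - P_H(W')) / (q - 1)`. -/
def weightedMap {N : ℕ} (μ : Fin (2 * N - 1) → ℝ) (f : Fin (2 * N - 1) → ℂ) (τ q : ℝ)
    (p : Matrix (Fin N) (Fin N) ℂ × Matrix (Fin N) (Fin N) ℂ) :
    Matrix (Fin N) (Fin N) ℂ × Matrix (Fin N) (Fin N) ℂ :=
  let V := (q : ℂ) • weightedU μ q (weightedData μ f q) p.2
  let W' := svCalc (sFun τ q) (V + projHankelPerp p.1)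
  (W', (1 / ((q : ℂ) - 1)) • (V - projHankel W'))

/-- The objective functional `a ↦ R_τ(Λ a) + ∑_l μ_l |a_l - f_l|²`. -/
def objective {N : ℕ} (μ : Fin (2 * N - 1) → ℝ) (f : Fin (2 * N - 1) → ℂ) (τ : ℝ)
    (a : Fin (2 * N - 1) → ℂ) : ℝ :=
  rankPenalty τ (hankel N a) + ∑ l, μ l * ‖a l - f l‖ ^ 2

/-- `x₀` is a stationary point of `g : E → ℝ` if `0` lies in the (Fréchet) subdifferential of `g`
at `x₀`, that is `liminf_{x → x₀} (g x - g x₀) / ‖x - x₀‖ ≥ 0`.  Where `g` is differentiable this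
says that the derivative vanishes, and for convex `g` that `x₀` is a minimizer. -/
def IsStationary {E : Type*} [NormedAddCommGroup E] (g : E → ℝ) (x₀ : E) : Prop :=
  ∀ ε > 0, ∀ᶠ x in nhds x₀, g x₀ - ε * ‖x - x₀‖ ≤ g x

end

end HankelApprox

namespace HankelApprox

open Matrix

noncomputable section

/-! ### The scalar potential -/

/-! Adding ‖A‖² to R_τ(A) produces Φ(A) = ∑ p(σ_j(A)) (`convexPenalty`), where the scalar p
(`potential`) is even and convex: 2τ|x| up to τ, then τ² + x². The diagonal of U*BV in any unitary
frames is dominated by doubly stochastic averages of the singular values of B, so Φ is the largest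
of the sums of p over such diagonals; this makes Φ convex and reduces its subgradients to those of
p.

Since ‖Λa‖² = ∑ β_l |a_l|², J is Φ ∘ Λ plus a quadratic whose gradient at a is -2βg with g = a - μ(a
- f)/β (`dualSeq`). Hence a is stationary iff 2Λg is a subgradient at Λa of Φ restricted to the
Hankel matrices (`isStationary_objective_iff`). By Hahn–Banach this means that some W with P_H(W) =
Λg has 2W ∈ ∂Φ(Λa) (`exists_isHalfSubgradient_iff`).

The singular value map is a resolvent: 2W ∈ ∂Φ(A) iff W = 𝔖_s(W + (q - 1)A)
(`isHalfSubgradient_iff`). A fixed point of the iteration amounts to A = Λa, P_H(W) = Λg and this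
equation (`isFixedPt_weightedMap_iff`), so the two sides agree.

The quadratic part has leading coefficients μ_l - β_l, which gives both convexity claims. -/

/-- The even extension of `σ ↦ τ² - max (τ - σ, 0)² + σ²`. -/
def potential (τ x : ℝ) : ℝ := τ ^ 2 - (max (τ - |x|) 0) ^ 2 + x ^ 2

theorem potential_neg (τ x : ℝ) : potential τ (-x) = potential τ x := by
  simp [potential]

theorem potential_abs (τ x : ℝ) : potential τ |x| = potential τ x := by
  simp [potential]

theorem potential_of_abs_le {τ x : ℝ} (h : |x| ≤ τ) : potential τ x = 2 * τ * |x| := by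
  rw [potential, max_eq_left (by linarith), ← sq_abs x]
  ring

theorem potential_of_le_abs {τ x : ℝ} (h : τ ≤ |x|) : potential τ x = τ ^ 2 + x ^ 2 := by
  rw [potential, max_eq_right (by linarith)]
  ring

/-- Subgradients of the potential at a nonnegative point. -/
theorem potential_subgradient {τ σ w : ℝ} (hτ : 0 < τ) (hσ : 0 ≤ σ)
    (h : (σ = 0 ∧ 0 ≤ w ∧ w ≤ τ) ∨ (σ ≤ τ ∧ w = τ) ∨ (τ ≤ σ ∧ w = σ)) (t : ℝ) :
    potential τ σ + 2 * w * (t - σ) ≤ potential τ t := by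
  have ht := le_abs_self t
  have ht0 := abs_nonneg t
  have hsq := sq_abs t
  -- The three cases are the vertical segment of p'/2 at the kink 0, the constant slope τ on [0, τ],
  -- and the slope σ beyond τ.
  rcases h with ⟨rfl, h0, h1⟩ | ⟨h0, rfl⟩ | ⟨h0, rfl⟩
  · rw [potential_of_abs_le (x := 0) (by simpa using hτ.le)]
    rcases le_total |t| τ with h | h
    · rw [potential_of_abs_le h]; simp; nlinarith
    · rw [potential_of_le_abs h]; simp; nlinarith [sq_nonneg (|t| - τ)]
  · rw [potential_of_abs_le (x := σ) (by rwa [abs_of_nonneg hσ]), abs_of_nonneg hσ]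
    rcases le_total |t| w with h | h
    · rw [potential_of_abs_le h]; nlinarith
    · rw [potential_of_le_abs h]; nlinarith [sq_nonneg (|t| - w)]
  · rw [potential_of_le_abs (x := w) (by rwa [abs_of_nonneg hσ])]
    rcases le_total |t| τ with h | h
    · rw [potential_of_abs_le h]; nlinarith [mul_nonneg (sub_nonneg.2 h0) (sub_nonneg.2 h)]
    · rw [potential_of_le_abs h]; nlinarith [sq_nonneg (t - w)]

theorem exists_potential_subgradient {τ : ℝ} (hτ : 0 < τ) (u : ℝ) :
    ∃ g : ℝ, ∀ t, potential τ u + g * (t - u) ≤ potential τ t := by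
  have key : ∀ u : ℝ, 0 ≤ u → ∃ g : ℝ, ∀ t, potential τ u + g * (t - u) ≤ potential τ t := by
    intro u hu
    rcases le_total u τ with h | h
    · exact ⟨2 * τ, potential_subgradient hτ hu (.inr (.inl ⟨h, rfl⟩))⟩
    · exact ⟨2 * u, potential_subgradient hτ hu (.inr (.inr ⟨h, rfl⟩))⟩
  rcases le_total 0 u with h | h
  · exact key u h
  · obtain ⟨g, hg⟩ := key (-u) (by linarith)
    refine ⟨-g, fun t => ?_⟩
    have := hg (-t)
    rw [potential_neg, potential_neg] at this
    linarith

/-- A function with an affine support at every point is convex: in the weighted sum of the support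
inequalities taken at the combination, the linear terms cancel. -/
theorem convexOn_potential {τ : ℝ} (hτ : 0 < τ) : ConvexOn ℝ Set.univ (potential τ) := by
  refine ⟨convex_univ, fun x _ y _ a b ha hb hab => ?_⟩
  obtain ⟨g, hg⟩ := exists_potential_subgradient hτ (a • x + b • y)
  have hx := mul_le_mul_of_nonneg_left (hg x) ha
  have hy := mul_le_mul_of_nonneg_left (hg y) hb
  obtain rfl : b = 1 - a := by linarith
  simp only [smul_eq_mul] at *
  linarith

theorem potential_le_potential {τ x y : ℝ} (hτ : 0 < τ) (h : |x| ≤ |y|) :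
    potential τ x ≤ potential τ y := by
  have hx := abs_nonneg x
  rcases le_total |x| τ with h1 | h1 <;> rcases le_total |y| τ with h2 | h2
  · rw [potential_of_abs_le h1, potential_of_abs_le h2]; nlinarith
  · rw [potential_of_abs_le h1, potential_of_le_abs h2, ← sq_abs y]; nlinarith
  · rw [potential_of_le_abs h1, potential_of_abs_le h2, ← sq_abs x]; nlinarith
  · rw [potential_of_le_abs h1, potential_of_le_abs h2, ← sq_abs x, ← sq_abs y]; nlinarith

theorem sFun_zero {τ q : ℝ} (hτ : 0 < τ) : sFun τ q 0 = 0 := by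
  simp [sFun, hτ.le]

/-- With w = s(x) and x = w + (q - 1)σ, the pair (σ, w) lies on the graph of half the
subdifferential of `potential`. The regimes x ≤ τ, τ ≤ x ≤ qτ and qτ ≤ x give the three
alternatives, in the form taken by `potential_subgradient`. -/
theorem sFun_cases {τ q x : ℝ} (hτ : 0 < τ) (hq : 1 < q) (hx : 0 ≤ x) :
    0 ≤ (x - sFun τ q x) / (q - 1) ∧
      (((x - sFun τ q x) / (q - 1) = 0 ∧ 0 ≤ sFun τ q x ∧ sFun τ q x ≤ τ) ∨
      ((x - sFun τ q x) / (q - 1) ≤ τ ∧ sFun τ q x = τ) ∨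
      (τ ≤ (x - sFun τ q x) / (q - 1) ∧ sFun τ q x = (x - sFun τ q x) / (q - 1))) := by
  have hq0 : 0 < q := by linarith
  have hq1 : 0 < q - 1 := by linarith
  have hxq : x / q ≤ x := div_le_self hx hq.le
  rcases le_total x τ with h | h
  · have : sFun τ q x = x := by rw [sFun, min_eq_left h, max_eq_left hxq]
    rw [this]; simp [hx, h]
  rcases le_total x (q * τ) with h' | h'
  · have : sFun τ q x = τ := by
      rw [sFun, min_eq_right h, max_eq_left]; rwa [div_le_iff₀' hq0]
    rw [this]
    exact ⟨div_nonneg (by linarith) hq1.le, .inr (.inl ⟨by rw [div_le_iff₀ hq1]; linarith, rfl⟩)⟩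
  · have h2 : τ ≤ x / q := by rwa [le_div_iff₀' hq0]
    have : sFun τ q x = x / q := by rw [sFun, min_eq_right h, max_eq_right h2]
    have h3 : (x - x / q) / (q - 1) = x / q := by field_simp
    rw [this, h3]
    exact ⟨by linarith, .inr (.inr ⟨h2, rfl⟩)⟩

/-! ### The real Frobenius pairing -/

/-- The real part of the Frobenius inner product. -/
def frobRe {n : Type*} [Fintype n] (W B : Matrix n n ℂ) : ℝ := ((Wᴴ * B).trace).re

section frobRe

variable {n : Type*} [Fintype n]

theorem frobRe_add_right (W A B : Matrix n n ℂ) :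
    frobRe W (A + B) = frobRe W A + frobRe W B := by
  simp [frobRe, Matrix.mul_add]

theorem frobRe_sub_right (W A B : Matrix n n ℂ) :
    frobRe W (A - B) = frobRe W A - frobRe W B := by
  simp [frobRe, Matrix.mul_sub]

theorem frobRe_sub_left (A B W : Matrix n n ℂ) :
    frobRe (A - B) W = frobRe A W - frobRe B W := by
  simp [frobRe, Matrix.sub_mul]

theorem frobRe_eq_sum (W B : Matrix n n ℂ) :
    frobRe W B = ∑ i, ∑ j, (star (W i j) * B i j).re := by
  rw [frobRe, Matrix.trace, Finset.sum_comm]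
  simp [Matrix.mul_apply]

theorem frobRe_self (A : Matrix n n ℂ) : frobRe A A = ∑ i, ∑ j, ‖A i j‖ ^ 2 := by
  rw [frobRe_eq_sum]
  simp [← Complex.normSq_eq_norm_sq, Complex.normSq_apply]

theorem frobRe_self_nonneg (A : Matrix n n ℂ) : 0 ≤ frobRe A A := by
  rw [frobRe_self]; positivity

theorem frobRe_self_eq_zero {A : Matrix n n ℂ} (h : frobRe A A = 0) : A = 0 := by
  rw [frobRe_self] at h
  ext i j
  have h1 := (Finset.sum_eq_zero_iff_of_nonneg (fun i _ => by positivity)).1 h i (Finset.mem_univ i)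
  have h2 := (Finset.sum_eq_zero_iff_of_nonneg (fun i _ => by positivity)).1 h1 j
    (Finset.mem_univ j)
  simpa using h2

/-- By cyclicity of the trace, the pairing sees only the diagonal of U*BV. -/
theorem frobRe_diagonal [DecidableEq n] (U V B : Matrix n n ℂ) (w : n → ℝ) :
    frobRe (U * Matrix.diagonal (fun j => (w j : ℂ)) * Vᴴ) B =
      ∑ j, w j * ((Uᴴ * B * V) j j).re := by
  have : (U * Matrix.diagonal (fun j => (w j : ℂ)) * Vᴴ)ᴴ * B =
      V * (Matrix.diagonal (fun j => (w j : ℂ)) * (Uᴴ * B)) := by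
    simp only [Matrix.conjTranspose_mul, Matrix.conjTranspose_conjTranspose,
      Matrix.diagonal_conjTranspose, Matrix.mul_assoc]
    congr 3
    ext j
    simp
  rw [frobRe, this, Matrix.trace_mul_comm, Matrix.mul_assoc, Matrix.trace]
  simp [Matrix.diagonal_mul]

end frobRe

/-! ### The convexified penalty -/

theorem sum_norm_sq_col {n : Type*} [Fintype n] [DecidableEq n] {U : Matrix n n ℂ}
    (hU : U ∈ Matrix.unitaryGroup n ℂ) (k : n) : ∑ j, ‖U j k‖ ^ 2 = 1 := by
  have h := congrFun (congrFun (Matrix.mem_unitaryGroup_iff'.mp hU) k) k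
  have h' := congrArg Complex.re h
  simpa [Matrix.star_eq_conjTranspose, Matrix.mul_apply, ← Complex.normSq_eq_norm_sq,
    Complex.normSq_apply] using h'

theorem sum_norm_sq_row {n : Type*} [Fintype n] [DecidableEq n] {U : Matrix n n ℂ}
    (hU : U ∈ Matrix.unitaryGroup n ℂ) (k : n) : ∑ j, ‖U k j‖ ^ 2 = 1 := by
  have h := congrFun (congrFun (Matrix.mem_unitaryGroup_iff.mp hU) k) k
  have h' := congrArg Complex.re h
  simpa [Matrix.star_eq_conjTranspose, Matrix.mul_apply, ← Complex.normSq_eq_norm_sq,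
    Complex.normSq_apply] using h'

/-- The diagonal of a matrix in any pair of orthonormal bases is dominated by the diagonal entries
of any of its singular value decompositions. -/
theorem sum_potential_diag_le {n : Type*} [Fintype n] [DecidableEq n] {τ : ℝ} (hτ : 0 < τ)
    {B U V P Q : Matrix n n ℂ} {s : n → ℝ}
    (hU : U ∈ Matrix.unitaryGroup n ℂ) (hV : V ∈ Matrix.unitaryGroup n ℂ)
    (hP : P ∈ Matrix.unitaryGroup n ℂ) (hQ : Q ∈ Matrix.unitaryGroup n ℂ)
    (hB : B = P * Matrix.diagonal (fun j => (s j : ℂ)) * Qᴴ) :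
    ∑ j, potential τ ((Uᴴ * B * V) j j).re ≤ ∑ j, potential τ (s j) := by
  have hC : Uᴴ * P ∈ Matrix.unitaryGroup n ℂ := mul_mem (Unitary.star_mem hU) hP
  have hD : Qᴴ * V ∈ Matrix.unitaryGroup n ℂ := mul_mem (Unitary.star_mem hQ) hV
  set C := Uᴴ * P with hCdef
  set D := Qᴴ * V with hDdef
  have hBC : Uᴴ * B * V = C * Matrix.diagonal (fun j => (s j : ℂ)) * D := by
    rw [hB, hCdef, hDdef]; simp only [Matrix.mul_assoc]
  -- This m is doubly stochastic, being an average of two unistochastic matrices, and by AM-GM it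
  -- dominates ‖C j k‖ ‖D k j‖, the weight of s k in the j-th diagonal entry.
  let m : n → n → ℝ := fun j k => (‖C j k‖ ^ 2 + ‖D k j‖ ^ 2) / 2
  have hm0 : ∀ j k, 0 ≤ m j k := fun j k => by positivity
  have hmrow : ∀ j, ∑ k, m j k = 1 := fun j => by
    simp only [m]
    rw [← Finset.sum_div, Finset.sum_add_distrib, sum_norm_sq_row hC, sum_norm_sq_col hD]
    norm_num
  have hmcol : ∀ k, ∑ j, m j k = 1 := fun k => by
    simp only [m]
    rw [← Finset.sum_div, Finset.sum_add_distrib, sum_norm_sq_col hC, sum_norm_sq_row hD]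
    norm_num
  have hdiag : ∀ j, |((Uᴴ * B * V) j j).re| ≤ ∑ k, m j k * |s k| := by
    intro j
    refine (Complex.abs_re_le_norm _).trans ?_
    rw [hBC, Matrix.mul_apply]
    refine (norm_sum_le _ _).trans (Finset.sum_le_sum fun k _ => ?_)
    rw [Matrix.mul_diagonal, norm_mul, norm_mul, Complex.norm_real, Real.norm_eq_abs]
    have : ‖C j k‖ * ‖D k j‖ ≤ m j k := by
      simp only [m]; nlinarith [sq_nonneg (‖C j k‖ - ‖D k j‖)]
    nlinarith [abs_nonneg (s k)]
  -- Monotonicity in |x| and Jensen use the row sums of m; the column sums then remove m.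
  calc ∑ j, potential τ ((Uᴴ * B * V) j j).re
      ≤ ∑ j, ∑ k, m j k * potential τ (s k) := by
        refine Finset.sum_le_sum fun j _ => ?_
        refine (potential_le_potential hτ ((hdiag j).trans (le_abs_self _))).trans ?_
        have := (convexOn_potential hτ).map_sum_le (t := Finset.univ) (w := m j)
          (p := fun k => |s k|) (fun k _ => hm0 j k) (hmrow j) (fun _ _ => Set.mem_univ _)
        simpa [potential_abs] using this
    _ = ∑ k, potential τ (s k) := by
        rw [Finset.sum_comm]
        simp [← Finset.sum_mul, hmcol]

/-- The convex function `R_τ(A) + ‖A‖²`. -/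
def convexPenalty {N : ℕ} (τ : ℝ) (A : Matrix (Fin N) (Fin N) ℂ) : ℝ :=
  ∑ j, potential τ (sv A j)

theorem sv_nonneg {N : ℕ} (A : Matrix (Fin N) (Fin N) ℂ) (j : Fin N) : 0 ≤ sv A j :=
  LinearMap.singularValues_nonneg _ _

theorem unitary_conj_diag {n : Type*} [Fintype n] [DecidableEq n] {U V : Matrix n n ℂ}
    (hU : U ∈ Matrix.unitaryGroup n ℂ) (hV : V ∈ Matrix.unitaryGroup n ℂ) (X : Matrix n n ℂ) :
    Uᴴ * (U * X * Vᴴ) * V = X := by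
  have hUU : Uᴴ * U = 1 := Matrix.mem_unitaryGroup_iff'.mp hU
  have hVV : Vᴴ * V = 1 := Matrix.mem_unitaryGroup_iff'.mp hV
  have : Uᴴ * (U * X * Vᴴ) * V = (Uᴴ * U) * X * (Vᴴ * V) := by simp only [Matrix.mul_assoc]
  rw [this, hUU, hVV, Matrix.one_mul, Matrix.mul_one]

/-- The numbers s need be neither ordered nor nonnegative, so the bound applies to a decomposition
inherited from another matrix. -/
theorem convexPenalty_le {N : ℕ} {τ : ℝ} (hτ : 0 < τ) {A P Q : Matrix (Fin N) (Fin N) ℂ}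
    {s : Fin N → ℝ} (hP : P ∈ Matrix.unitaryGroup (Fin N) ℂ)
    (hQ : Q ∈ Matrix.unitaryGroup (Fin N) ℂ)
    (hA : A = P * Matrix.diagonal (fun j => (s j : ℂ)) * Qᴴ) :
    convexPenalty τ A ≤ ∑ j, potential τ (s j) := by
  obtain ⟨⟨U, V⟩, hU, hV, h⟩ := exists_isSVD A
  have := sum_potential_diag_le hτ hU hV hP hQ hA
  rw [h] at this
  simp only at this
  rw [unitary_conj_diag hU hV] at this
  simpa [convexPenalty] using this

theorem sum_potential_le_convexPenalty {N : ℕ} {τ : ℝ} (hτ : 0 < τ)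
    (B : Matrix (Fin N) (Fin N) ℂ) {U V : Matrix (Fin N) (Fin N) ℂ}
    (hU : U ∈ Matrix.unitaryGroup (Fin N) ℂ) (hV : V ∈ Matrix.unitaryGroup (Fin N) ℂ) :
    ∑ j, potential τ ((Uᴴ * B * V) j j).re ≤ convexPenalty τ B := by
  obtain ⟨⟨P, Q⟩, hP, hQ, h⟩ := exists_isSVD B
  exact sum_potential_diag_le hτ hU hV hP hQ h

/-- In the singular frames of the combination, its singular values are the combinations of the
diagonals of U*AV and U*BV. Scalar convexity applies entrywise, and each diagonal sum is at most the
penalty. -/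
theorem convexOn_convexPenalty {N : ℕ} {τ : ℝ} (hτ : 0 < τ) :
    ConvexOn ℝ Set.univ (convexPenalty (N := N) τ) := by
  refine ⟨convex_univ, fun A _ B _ a b ha hb hab => ?_⟩
  obtain ⟨⟨U, V⟩, hU, hV, h⟩ := exists_isSVD (a • A + b • B)
  have hdiag : ∀ j, sv (a • A + b • B) j =
      a • ((Uᴴ * A * V) j j).re + b • ((Uᴴ * B * V) j j).re := by
    intro j
    have h1 : Uᴴ * (a • A + b • B) * V = a • (Uᴴ * A * V) + b • (Uᴴ * B * V) := by
      simp [Matrix.mul_add, Matrix.add_mul]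
    have h2 := congrArg (fun X => Uᴴ * X * V) h
    simp only [unitary_conj_diag hU hV] at h2
    rw [h1] at h2
    have h3 := congrArg Complex.re (congrFun (congrFun h2 j) j)
    simpa using h3.symm
  calc convexPenalty τ (a • A + b • B)
      ≤ ∑ j, (a * potential τ ((Uᴴ * A * V) j j).re + b * potential τ ((Uᴴ * B * V) j j).re) := by
        refine Finset.sum_le_sum fun j _ => ?_
        rw [hdiag]
        exact (convexOn_potential hτ).2 (Set.mem_univ _) (Set.mem_univ _) ha hb hab
    _ = a * ∑ j, potential τ ((Uᴴ * A * V) j j).re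
        + b * ∑ j, potential τ ((Uᴴ * B * V) j j).re := by
        rw [Finset.sum_add_distrib, Finset.mul_sum, Finset.mul_sum]
    _ ≤ a • convexPenalty τ A + b • convexPenalty τ B :=
        add_le_add (mul_le_mul_of_nonneg_left (sum_potential_le_convexPenalty hτ A hU hV) ha)
          (mul_le_mul_of_nonneg_left (sum_potential_le_convexPenalty hτ B hU hV) hb)

theorem convexPenalty_eq {N : ℕ} (τ : ℝ) (A : Matrix (Fin N) (Fin N) ℂ) :
    convexPenalty τ A = rankPenalty τ A + frobRe A A := by
  obtain ⟨⟨U, V⟩, hU, hV, h⟩ := exists_isSVD A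
  have h1 : frobRe A A = ∑ j, sv A j ^ 2 := by
    have h2 : Uᴴ * A * V = Matrix.diagonal (fun j => (sv A j : ℂ)) := by
      have h3 := congrArg (fun X => Uᴴ * X * V) h
      simpa only [unitary_conj_diag hU hV] using h3
    have h4 := frobRe_diagonal U V A (sv A)
    simp only at h
    rw [← h, h2] at h4
    simpa [sq] using h4
  rw [h1, convexPenalty, rankPenalty, ← Finset.sum_add_distrib]
  simp [potential, abs_of_nonneg (sv_nonneg A _)]

/-! ### Subgradients of the convexified penalty -/

/-- `W` is one half of a subgradient of `convexPenalty τ` at `A`. -/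
def IsHalfSubgradient {N : ℕ} (τ : ℝ) (A W : Matrix (Fin N) (Fin N) ℂ) : Prop :=
  ∀ B, convexPenalty τ A + 2 * frobRe W (B - A) ≤ convexPenalty τ B

/-- X, its image W and A are diagonal in the same frames, with entries related by x = w + (q - 1)σ.
Summing the scalar subgradient inequalities against the diagonal of U*BV suffices: Φ(A) is at most
the sum at σ, and Φ(B) at least the sum over that diagonal. -/
theorem isHalfSubgradient_svCalc {N : ℕ} {τ q : ℝ} (hτ : 0 < τ) (hq : 1 < q)
    {A X : Matrix (Fin N) (Fin N) ℂ} (hA : ((q : ℂ) - 1) • A = X - svCalc (sFun τ q) X) :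
    IsHalfSubgradient τ A (svCalc (sFun τ q) X) := by
  obtain ⟨⟨U, V⟩, hU, hV, h⟩ := exists_isSVD X
  have hq1 : (q : ℂ) - 1 ≠ 0 := by
    exact_mod_cast (sub_pos.2 hq).ne'
  have hW := svCalc_eq (f := sFun τ q) (sFun_zero hτ) (sv_nonneg X) hU hV h
  set W := svCalc (sFun τ q) X with hWdef
  let w : Fin N → ℝ := fun j => sFun τ q (sv X j)
  let σ : Fin N → ℝ := fun j => (sv X j - w j) / (q - 1)
  have hAσ : A = U * Matrix.diagonal (fun j => (σ j : ℂ)) * Vᴴ := by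
    have h1 : A = ((q : ℂ) - 1)⁻¹ • (X - W) := by rw [← hA, inv_smul_smul₀ hq1]
    rw [h1, hW]
    nth_rewrite 1 [h]
    simp only
    rw [← Matrix.sub_mul, ← Matrix.mul_sub, Matrix.diagonal_sub, ← Matrix.smul_mul,
      ← Matrix.mul_smul, ← Matrix.diagonal_smul]
    congr 3
    ext j
    simp [σ, w, div_eq_inv_mul]
  intro B
  have h2 := sum_potential_le_convexPenalty hτ B hU hV
  have h3 := convexPenalty_le hτ hU hV hAσ
  have h4 : frobRe W A = ∑ j, w j * σ j := by
    rw [hW, frobRe_diagonal, hAσ, unitary_conj_diag hU hV]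
    simp [w]
  rw [frobRe_sub_right, h4]
  have h5 : frobRe W B = ∑ j, w j * ((Uᴴ * B * V) j j).re := by rw [hW, frobRe_diagonal]
  rw [h5]
  have h6 : ∑ j, potential τ (σ j) + 2 * (∑ j, w j * ((Uᴴ * B * V) j j).re - ∑ j, w j * σ j) ≤
      ∑ j, potential τ ((Uᴴ * B * V) j j).re := by
    rw [← Finset.sum_sub_distrib, Finset.mul_sum, ← Finset.sum_add_distrib]
    refine Finset.sum_le_sum fun j _ => ?_
    obtain ⟨h7, h8⟩ := sFun_cases hτ hq (sv_nonneg X j)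
    have := potential_subgradient hτ h7 h8 ((Uᴴ * B * V) j j).re
    simp only [σ, w]
    linarith
  linarith

/-- Half subgradients of `convexPenalty τ` are characterized by the singular value functional
calculus of `sFun τ q`. -/
theorem isHalfSubgradient_iff {N : ℕ} {τ q : ℝ} (hτ : 0 < τ) (hq : 1 < q)
    {A W : Matrix (Fin N) (Fin N) ℂ} :
    IsHalfSubgradient τ A W ↔ svCalc (sFun τ q) (W + ((q : ℂ) - 1) • A) = W := by
  have hq1 : (q : ℂ) - 1 ≠ 0 := by exact_mod_cast (sub_pos.2 hq).ne'
  constructor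
  · intro h
    -- W₁ is a half subgradient at A₁, and W₁ + (q - 1)A₁ = X = W + (q - 1)A. Monotonicity of the
    -- subdifferential then gives (q - 1)‖A₁ - A‖² ≤ 0, whence W₁ = W.
    set X := W + ((q : ℂ) - 1) • A with hX
    set W₁ := svCalc (sFun τ q) X with hW₁
    set A₁ := ((q : ℂ) - 1)⁻¹ • (X - W₁) with hA₁
    have h1 : ((q : ℂ) - 1) • A₁ = X - W₁ := by rw [hA₁, smul_inv_smul₀ hq1]
    have h2 := isHalfSubgradient_svCalc hτ hq h1 A
    have h3 := h A₁
    have h4 : W - W₁ = ((q : ℂ) - 1) • (A₁ - A) := by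
      rw [smul_sub, h1, hX]; abel
    have h5 : frobRe (W - W₁) (A₁ - A) = (q - 1) * frobRe (A₁ - A) (A₁ - A) := by
      rw [h4, frobRe, frobRe, Matrix.conjTranspose_smul, Matrix.smul_mul, Matrix.trace_smul]
      simp
    have h6 : frobRe (W - W₁) (A₁ - A) ≤ 0 := by
      rw [frobRe_sub_left]
      have : frobRe W₁ (A₁ - A) = - frobRe W₁ (A - A₁) := by
        rw [frobRe_sub_right, frobRe_sub_right]; ring
      linarith
    have h7 : frobRe (A₁ - A) (A₁ - A) = 0 := by
      have := frobRe_self_nonneg (A₁ - A)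
      nlinarith
    have h8 := frobRe_self_eq_zero h7
    rw [h8, smul_zero] at h4
    exact (sub_eq_zero.1 h4).symm
  · intro h
    have := isHalfSubgradient_svCalc (A := A) (X := W + ((q : ℂ) - 1) • A) hτ hq
      (by rw [h]; abel)
    rwa [h] at this

/-! ### Extension of subgradients -/

/-- A subgradient along a subspace of a finite convex function extends to a subgradient. -/
theorem exists_subgradient_extension {E : Type*} [NormedAddCommGroup E] [NormedSpace ℝ E]
    [FiniteDimensional ℝ E] {φ : E → ℝ} (hφ : ConvexOn ℝ Set.univ φ) (S : Submodule ℝ E) (a : E)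
    (g : E →ₗ[ℝ] ℝ) (h : ∀ x ∈ S, φ a + g x ≤ φ (a + x)) :
    ∃ L : E →ₗ[ℝ] ℝ, (∀ x ∈ S, L x = g x) ∧ ∀ x, φ a + L x ≤ φ (a + x) := by
  have hcont : Continuous φ := continuousOn_univ.1 (hφ.continuousOn isOpen_univ)
  have hψ : ConvexOn ℝ Set.univ fun x => φ (a + x) - φ a := by
    refine ⟨convex_univ, fun x _ y _ s t hs ht hst => ?_⟩
    have h1 := hφ.2 (Set.mem_univ (a + x)) (Set.mem_univ (a + y)) hs ht hst
    have h2 : s • (a + x) + t • (a + y) = a + (s • x + t • y) := by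
      rw [smul_add, smul_add, add_add_add_comm, ← add_smul, hst, one_smul]
    rw [h2] at h1
    obtain rfl : t = 1 - s := by linarith
    simp only [smul_eq_mul] at *
    linarith
  -- The open strict epigraph of x ↦ φ(a + x) - φ(a) is separated from the graph of g over S.
  have hC₁ : Convex ℝ {p : E × ℝ | φ (a + p.1) - φ a < p.2} := by
    simpa using hψ.convex_strict_epigraph
  have hO₁ : IsOpen {p : E × ℝ | φ (a + p.1) - φ a < p.2} :=
    isOpen_lt (by fun_prop) continuous_snd
  have hC₂ : Convex ℝ {p : E × ℝ | p.1 ∈ S ∧ p.2 = g p.1} := by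
    rintro ⟨x, r⟩ ⟨hx, hr⟩ ⟨y, r'⟩ ⟨hy, hr'⟩ s t - - -
    simp only at hr hr' hx hy
    subst hr hr'
    exact ⟨S.add_mem (S.smul_mem s hx) (S.smul_mem t hy), by simp⟩
  obtain ⟨f, u, hf₁, hf₂⟩ := geometric_hahn_banach_open hC₁ hO₁ hC₂ (by
    rw [Set.disjoint_left]
    rintro ⟨x, r⟩ hx ⟨hxS, hr⟩
    have := h x hxS
    simp only [Set.mem_ofPred_eq] at hx hr
    linarith)
  have hsplit : ∀ x r, f (x, r) = f (x, 0) + r * f (0, 1) := by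
    intro x r
    rw [← smul_eq_mul, ← map_smul, ← map_add]
    simp
  have hu : u ≤ 0 := by
    have := hf₂ (0, 0) ⟨S.zero_mem, by simp⟩
    rwa [Prod.mk_zero_zero, map_zero] at this
  have hc : f (0, 1) < 0 := by
    have := hf₁ (0, 1) (by simp)
    linarith
  -- The separating functional is bounded below on the graph, which is a linear subspace, so it
  -- vanishes there; the multiple (u - 1)/ℓ would otherwise give u ≤ u - 1.
  have hfS : ∀ x ∈ S, f (x, 0) + g x * f (0, 1) = 0 := by
    intro x hx
    by_contra hne
    set ℓ := f (x, 0) + g x * f (0, 1) with hℓ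
    have hk : ∀ k : ℝ, u ≤ k * ℓ := by
      intro k
      have := hf₂ (k • x, g (k • x)) ⟨S.smul_mem k hx, rfl⟩
      rw [hsplit] at this
      have h2 : f (k • x, 0) = k * f (x, 0) := by
        rw [← smul_eq_mul, ← map_smul]; simp
      rw [h2, map_smul, smul_eq_mul] at this
      rw [hℓ]; linarith
    have := hk ((u - 1) / ℓ)
    rw [div_mul_cancel₀ _ hne] at this
    linarith
  -- L is defined by f(x, L x) = 0, which is solvable because f(0, 1) < 0.
  refine ⟨(-f (0, 1))⁻¹ • (f.toLinearMap ∘ₗ LinearMap.inl ℝ E ℝ), fun x hx => ?_, fun x => ?_⟩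
  · have := hfS x hx
    simp only [LinearMap.smul_apply, LinearMap.comp_apply, LinearMap.inl_apply, smul_eq_mul,
      ContinuousLinearMap.coe_coe]
    rw [inv_mul_eq_div, div_eq_iff (by linarith)]
    linarith
  · have hle : ((-f (0, 1))⁻¹ • (f.toLinearMap ∘ₗ LinearMap.inl ℝ E ℝ)) x ≤ φ (a + x) - φ a := by
      refine le_of_forall_gt fun r hr => ?_
      have := hf₁ (x, r) hr
      rw [hsplit] at this
      simp only [LinearMap.smul_apply, LinearMap.comp_apply, LinearMap.inl_apply, smul_eq_mul,
        ContinuousLinearMap.coe_coe]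
      rw [inv_mul_eq_div, div_lt_iff₀ (by linarith)]
      linarith
    linarith

/-- Real linear functionals on complex matrices are represented by the Frobenius pairing. -/
theorem exists_frobRe_eq {n : Type*} [Fintype n] [DecidableEq n] (L : Matrix n n ℂ →ₗ[ℝ] ℝ) :
    ∃ W : Matrix n n ℂ, ∀ B, L B = frobRe W B := by
  refine ⟨Matrix.of fun i j => ⟨L (Matrix.single i j 1), L (Matrix.single i j Complex.I)⟩,
    fun B => ?_⟩
  have hB : B = ∑ i, ∑ j, ((B i j).re • Matrix.single i j (1 : ℂ) +
      (B i j).im • Matrix.single i j Complex.I) := by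
    conv_lhs => rw [Matrix.matrix_eq_sum_single B]
    refine Finset.sum_congr rfl fun i _ => Finset.sum_congr rfl fun j _ => ?_
    rw [Matrix.smul_single, Matrix.smul_single, ← Matrix.single_add]
    congr 1
    simp [Complex.re_add_im]
  conv_lhs => rw [hB]
  rw [frobRe_eq_sum]
  simp only [map_sum, map_add, map_smul, smul_eq_mul]
  refine Finset.sum_congr rfl fun i _ => Finset.sum_congr rfl fun j _ => ?_
  simp
  ring

/-! ### Hankel matrices -/

theorem antidiagCount_pos (N : ℕ) (l : Fin (2 * N - 1)) : 0 < antidiagCount N l := by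
  have hl := l.2
  have h0 : ∀ j k : Fin N, (0 : ℝ) ≤ if (j : ℕ) + k = l then 1 else 0 := fun j k => by
    split_ifs <;> norm_num
  refine Finset.sum_pos' (fun j _ => Finset.sum_nonneg fun k _ => h0 j k)
    -- Taking j = min(l, N - 1) leaves k = l - j ≤ N - 1, because l ≤ 2N - 2.
    ⟨⟨min (l : ℕ) (N - 1), by omega⟩, Finset.mem_univ _, ?_⟩
  refine Finset.sum_pos' (fun k _ => h0 _ k) ⟨⟨l - min (l : ℕ) (N - 1), by omega⟩, Finset.mem_univ _, ?_⟩
  rw [if_pos]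
  · norm_num
  · simp only; omega

theorem sum_mul_hankel {N : ℕ} (W : Matrix (Fin N) (Fin N) ℂ) (b : Fin (2 * N - 1) → ℂ) :
    ∑ j, ∑ k, W j k * hankel N b j k = ∑ l, hankelAdj W l * b l := by
  simp only [hankelAdj, Finset.sum_mul]
  rw [Finset.sum_comm]
  rw [Finset.sum_comm]
  rw [Finset.sum_comm (s := (Finset.univ : Finset (Fin (2 * N - 1))))]
  refine Finset.sum_congr rfl fun j _ => ?_
  rw [Finset.sum_comm]
  refine Finset.sum_congr rfl fun k _ => ?_
  rw [Finset.sum_eq_single (⟨j + k, by omega⟩ : Fin (2 * N - 1))]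
  · simp [hankel]
  · intro l _ hl
    rw [if_neg, zero_mul]
    intro h
    exact hl (Fin.ext h.symm)
  · simp

theorem hankelAdj_hankel {N : ℕ} (a : Fin (2 * N - 1) → ℂ) (l : Fin (2 * N - 1)) :
    hankelAdj (hankel N a) l = antidiagCount N l * a l := by
  simp only [hankelAdj, antidiagCount, Complex.ofReal_sum, Finset.sum_mul]
  refine Finset.sum_congr rfl fun j _ => Finset.sum_congr rfl fun k _ => ?_
  split_ifs with h
  · have hl : (⟨j + k, by omega⟩ : Fin (2 * N - 1)) = l := Fin.ext h
    simp [hankel, hl]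
  · simp

theorem hankelAdj_sub {N : ℕ} (A B : Matrix (Fin N) (Fin N) ℂ) (l : Fin (2 * N - 1)) :
    hankelAdj (A - B) l = hankelAdj A l - hankelAdj B l := by
  simp only [hankelAdj, ← Finset.sum_sub_distrib]
  refine Finset.sum_congr rfl fun j _ => Finset.sum_congr rfl fun k _ => ?_
  split_ifs <;> simp

theorem sum_star_mul_hankel {N : ℕ} (W : Matrix (Fin N) (Fin N) ℂ) (b : Fin (2 * N - 1) → ℂ) :
    ∑ j, ∑ k, star (W j k) * hankel N b j k = ∑ l, star (hankelAdj W l) * b l := by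
  have h := sum_mul_hankel (W.map star) b
  simp only [Matrix.map_apply] at h
  rw [h]
  refine Finset.sum_congr rfl fun l _ => ?_
  congr 1
  simp only [hankelAdj, star_sum]
  refine Finset.sum_congr rfl fun j _ => Finset.sum_congr rfl fun k _ => ?_
  split_ifs <;> simp

theorem frobRe_hankel {N : ℕ} (W : Matrix (Fin N) (Fin N) ℂ) (b : Fin (2 * N - 1) → ℂ) :
    frobRe W (hankel N b) = ∑ l, (star (hankelAdj W l) * b l).re := by
  rw [frobRe_eq_sum, ← Complex.re_sum, ← sum_star_mul_hankel]
  simp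

theorem frobRe_hankel_hankel {N : ℕ} (a b : Fin (2 * N - 1) → ℂ) :
    frobRe (hankel N a) (hankel N b) = ∑ l, antidiagCount N l * (star (a l) * b l).re := by
  rw [frobRe_hankel]
  refine Finset.sum_congr rfl fun l _ => ?_
  rw [hankelAdj_hankel]
  simp
  ring

/-- Λ*Λ is multiplication by β, so the projection Λ(Λ*Λ)⁻¹Λ* is Λβ⁻¹Λ*. -/
theorem projHankel_eq {N : ℕ} (W : Matrix (Fin N) (Fin N) ℂ) :
    projHankel W = hankel N fun l => hankelAdj W l / antidiagCount N l := by
  rw [projHankel, LinearEquiv.symm_apply_eq]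
  refine Submodule.eq_starProjection_of_mem_of_inner_eq_zero ?_ ?_
  · exact Submodule.mem_map_of_mem (LinearMap.mem_range_self _ _)
  · rintro _ ⟨_, ⟨b, rfl⟩, rfl⟩
    have h : ∀ A B : Matrix (Fin N) (Fin N) ℂ, inner ℂ (toFrobenius N A) (toFrobenius N B) =
        ∑ j, ∑ k, star (A j k) * B j k := by
      intro A B
      rw [PiLp.inner_apply, Fintype.sum_prod_type]
      refine Finset.sum_congr rfl fun j _ => Finset.sum_congr rfl fun k _ => ?_
      simp [toFrobenius, mul_comm]
    rw [← map_sub]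
    refine (h _ _).trans ?_
    rw [sum_star_mul_hankel]
    refine Finset.sum_eq_zero fun l _ => ?_
    have : (antidiagCount N l : ℂ) ≠ 0 := by exact_mod_cast (antidiagCount_pos N l).ne'
    rw [hankelAdj_sub, hankelAdj_hankel, mul_div_cancel₀ _ this]
    simp

theorem projHankelPerp_eq {N : ℕ} (W : Matrix (Fin N) (Fin N) ℂ) :
    projHankelPerp W = W - projHankel W := by
  rw [projHankelPerp, projHankel, Submodule.starProjection_orthogonal_val, map_sub,
    LinearEquiv.symm_apply_apply]

/-- A matrix projects to a given Hankel matrix iff both induce the same functional on the space of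
Hankel matrices. -/
theorem projHankel_eq_hankel_iff {N : ℕ} (W : Matrix (Fin N) (Fin N) ℂ)
    (g : Fin (2 * N - 1) → ℂ) :
    projHankel W = hankel N g ↔ ∀ b, frobRe W (hankel N b) = frobRe (hankel N g) (hankel N b) := by
  have hβ : ∀ l, (antidiagCount N l : ℂ) ≠ 0 := fun l => by
    exact_mod_cast (antidiagCount_pos N l).ne'
  rw [projHankel_eq]
  constructor
  · intro h b
    rw [← h, frobRe_hankel, frobRe_hankel]
    refine Finset.sum_congr rfl fun l _ => ?_
    rw [hankelAdj_hankel, mul_div_cancel₀ _ (hβ l)]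
  · intro h
    congr 1
    -- Testing with b = Λ*(W - Λg) turns the hypothesis into the vanishing of the squared norm of b.
    have h1 := h fun l => hankelAdj (W - hankel N g) l
    rw [← sub_eq_zero, ← frobRe_sub_left, frobRe_hankel] at h1
    have h2 : ∀ z : ℂ, 0 ≤ (star z * z).re := fun z => by
      simp only [Complex.star_def, Complex.mul_re, Complex.conj_re, Complex.conj_im]
      nlinarith [mul_self_nonneg z.re, mul_self_nonneg z.im]
    rw [Finset.sum_eq_zero_iff_of_nonneg (fun l _ => h2 _)] at h1
    funext l
    have h3 := h1 l (Finset.mem_univ l)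
    have h4 : hankelAdj (W - hankel N g) l = 0 := by
      rw [Complex.star_def, ← Complex.normSq_eq_conj_mul_self, Complex.ofReal_re,
        Complex.normSq_eq_zero] at h3
      exact h3
    rw [hankelAdj_sub, hankelAdj_hankel, sub_eq_zero] at h4
    rw [h4, mul_div_cancel_left₀ _ (hβ l)]

/-! ### Fixed points -/

/-- The sequence `a - μ (a - f) / β`, which is the gradient, up to a factor `-2 β`, of the smooth
part `a ↦ ∑ l, (μ_l |a_l - f_l|² - β_l |a_l|²)` of the objective functional. -/
def dualSeq {N : ℕ} (μ : Fin (2 * N - 1) → ℝ) (f a : Fin (2 * N - 1) → ℂ) :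
    Fin (2 * N - 1) → ℂ :=
  fun l => a l - μ l * (a l - f l) / antidiagCount N l

theorem smul_weightedU_hankel {N : ℕ} (μ : Fin (2 * N - 1) → ℝ) (f : Fin (2 * N - 1) → ℂ) {q : ℝ}
    (hq : 1 < q) (a : Fin (2 * N - 1) → ℂ) :
    (q : ℂ) • weightedU μ q (weightedData μ f q) (hankel N a) =
      ((q : ℂ) - 1) • hankel N a + hankel N (dualSeq μ f a) := by
  have hq0 : (q : ℂ) ≠ 0 := by exact_mod_cast (by linarith : q ≠ 0)
  rw [weightedU, weightedData]
  simp only [← map_add, ← map_sub, ← map_smul]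
  congr 1
  funext l
  have hβ : (antidiagCount N l : ℂ) ≠ 0 := by exact_mod_cast (antidiagCount_pos N l).ne'
  simp only [Pi.smul_apply, Pi.add_apply, Pi.sub_apply, smul_eq_mul, dualSeq, hankelAdj_hankel]
  field_simp
  ring

/-- The second equation reads (q - 1)A = V - P_H(W). Since V - qA is always Hankel, A is Hankel, and
its sequence a then determines P_H(W) as Λ of `dualSeq`. The argument of 𝔖 becomes V + W - P_H(W) =
W + (q - 1)A. -/
theorem isFixedPt_weightedMap_iff {N : ℕ} (μ : Fin (2 * N - 1) → ℝ) (f : Fin (2 * N - 1) → ℂ)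
    (τ : ℝ) {q : ℝ} (hq : 1 < q) (W A : Matrix (Fin N) (Fin N) ℂ) :
    Function.IsFixedPt (weightedMap μ f τ q) (W, A) ↔
      ∃ a, A = hankel N a ∧ projHankel W = hankel N (dualSeq μ f a) ∧
        svCalc (sFun τ q) (W + ((q : ℂ) - 1) • A) = W := by
  have hq1 : (q : ℂ) - 1 ≠ 0 := by exact_mod_cast (sub_pos.2 hq).ne'
  rw [Function.IsFixedPt, weightedMap, Prod.mk.injEq, projHankelPerp_eq]
  set V := (q : ℂ) • weightedU μ q (weightedData μ f q) A with hV
  constructor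
  · rintro ⟨hW, hA⟩
    rw [hW] at hA
    have h1 : ((q : ℂ) - 1) • A = V - projHankel W := by
      rw [← hA, one_div, smul_inv_smul₀ hq1]
    have h2 : ∃ a, A = hankel N a := by
      have h4 : A = projHankel W - (V - (q : ℂ) • A) := by
        rw [sub_smul, one_smul] at h1
        have : projHankel W = V - ((q : ℂ) • A - A) := by rw [h1]; abel
        rw [this]; abel
      have h5 : V - (q : ℂ) • A ∈ hankelSpace N := by
        have : V - (q : ℂ) • A = (q : ℂ) • (weightedData μ f q - hankel N fun l =>
            (μ l : ℂ) / ((q : ℂ) * (antidiagCount N l : ℂ) ^ 2) * hankelAdj A l) := by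
          rw [hV, weightedU, ← smul_sub]; congr 1; abel
        rw [this]
        exact Submodule.smul_mem _ _ (Submodule.sub_mem _ (LinearMap.mem_range_self _ _)
          (LinearMap.mem_range_self _ _))
      have h6 : A ∈ hankelSpace N := by
        rw [h4, projHankel_eq]
        exact Submodule.sub_mem _ (LinearMap.mem_range_self _ _) h5
      obtain ⟨a, ha⟩ := h6
      exact ⟨a, ha.symm⟩
    obtain ⟨a, rfl⟩ := h2
    refine ⟨a, rfl, ?_, ?_⟩
    · rw [hV, smul_weightedU_hankel μ f hq] at h1
      have := congrArg (fun X => X + projHankel W - ((q : ℂ) - 1) • hankel N a) h1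
      simpa using this
    · rw [h1]
      convert hW using 2
      abel
  · rintro ⟨a, rfl, h1, h2⟩
    rw [smul_weightedU_hankel μ f hq] at hV
    have h3 : V + (W - projHankel W) = W + ((q : ℂ) - 1) • hankel N a := by
      rw [hV, h1]; abel
    rw [h3, h2, h1, hV, add_sub_cancel_right, one_div, inv_smul_smul₀ hq1]
    exact ⟨rfl, rfl⟩

/-! ### Stationary points -/

theorem objective_eq {N : ℕ} (μ : Fin (2 * N - 1) → ℝ) (f : Fin (2 * N - 1) → ℂ) (τ : ℝ)
    (a : Fin (2 * N - 1) → ℂ) :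
    objective μ f τ a = convexPenalty τ (hankel N a) +
      ∑ l, (μ l * ‖a l - f l‖ ^ 2 - antidiagCount N l * ‖a l‖ ^ 2) := by
  have : frobRe (hankel N a) (hankel N a) = ∑ l, antidiagCount N l * ‖a l‖ ^ 2 := by
    rw [frobRe_hankel_hankel]
    refine Finset.sum_congr rfl fun l _ => ?_
    rw [Complex.star_def, ← Complex.normSq_eq_conj_mul_self, Complex.ofReal_re,
      Complex.normSq_eq_norm_sq]
  rw [convexPenalty_eq, this, Finset.sum_sub_distrib, objective]
  ring

/-- The smooth part is quadratic, so its expansion at a is exact and the remainder has coefficients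
μ - β. -/
theorem objective_sub {N : ℕ} (μ : Fin (2 * N - 1) → ℝ) (f : Fin (2 * N - 1) → ℂ) (τ : ℝ)
    (a b : Fin (2 * N - 1) → ℂ) :
    objective μ f τ b - objective μ f τ a =
      convexPenalty τ (hankel N b) - convexPenalty τ (hankel N a)
        - 2 * frobRe (hankel N (dualSeq μ f a)) (hankel N (b - a))
        + ∑ l, (μ l - antidiagCount N l) * ‖b l - a l‖ ^ 2 := by
  rw [objective_eq, objective_eq, frobRe_hankel_hankel]
  have : ∑ l, (μ l * ‖b l - f l‖ ^ 2 - antidiagCount N l * ‖b l‖ ^ 2) -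
      ∑ l, (μ l * ‖a l - f l‖ ^ 2 - antidiagCount N l * ‖a l‖ ^ 2) =
      -(2 * ∑ l, antidiagCount N l * (star (dualSeq μ f a l) * (b - a) l).re) +
        ∑ l, (μ l - antidiagCount N l) * ‖b l - a l‖ ^ 2 := by
    rw [Finset.mul_sum, ← Finset.sum_sub_distrib, ← Finset.sum_neg_distrib,
      ← Finset.sum_add_distrib]
    refine Finset.sum_congr rfl fun l _ => ?_
    have hβ := (antidiagCount_pos N l).ne'
    have h1 : (dualSeq μ f a l).re =
        (a l).re - μ l * ((a l).re - (f l).re) / antidiagCount N l := by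
      simp [dualSeq, Complex.div_ofReal_re]
    have h2 : (dualSeq μ f a l).im =
        (a l).im - μ l * ((a l).im - (f l).im) / antidiagCount N l := by
      simp [dualSeq, Complex.div_ofReal_im]
    simp only [← Complex.normSq_eq_norm_sq, Complex.normSq_apply, Complex.star_def, Complex.mul_re,
      Complex.conj_re, Complex.conj_im, Pi.sub_apply, Complex.sub_re, Complex.sub_im, h1, h2]
    field_simp
    ring
  linarith

/-- The quadratic remainder is negligible to first order, so stationarity is a first-order lower
bound on Φ ∘ Λ near a; convexity along the segment to a + d makes it global. The norm is the sup
norm, which is harmless since all norms are equivalent in finite dimension. -/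
theorem isStationary_objective_iff {N : ℕ} (μ : Fin (2 * N - 1) → ℝ) (f : Fin (2 * N - 1) → ℂ)
    {τ : ℝ} (hτ : 0 < τ) (a : Fin (2 * N - 1) → ℂ) :
    IsStationary (objective μ f τ) a ↔ ∀ d, convexPenalty τ (hankel N a) +
      2 * frobRe (hankel N (dualSeq μ f a)) (hankel N d) ≤ convexPenalty τ (hankel N (a + d)) := by
  set K : ℝ := ∑ l, |μ l - antidiagCount N l| with hK
  have hK0 : 0 ≤ K := Finset.sum_nonneg fun l _ => abs_nonneg _
  have hquad : ∀ d : Fin (2 * N - 1) → ℂ,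
      |∑ l, (μ l - antidiagCount N l) * ‖d l‖ ^ 2| ≤ K * ‖d‖ ^ 2 := by
    intro d
    rw [hK, Finset.sum_mul]
    refine (Finset.abs_sum_le_sum_abs _ _).trans (Finset.sum_le_sum fun l _ => ?_)
    rw [abs_mul, abs_of_nonneg (by positivity : 0 ≤ ‖d l‖ ^ 2)]
    gcongr
    exact norm_le_pi_norm d l
  constructor
  · intro h d
    refine le_of_forall_pos_le_add fun δ hδ => ?_
    set D := convexPenalty τ (hankel N (a + d)) - convexPenalty τ (hankel N a) -
      2 * frobRe (hankel N (dualSeq μ f a)) (hankel N d) with hD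
    have hε : 0 < δ / (2 * (‖d‖ + 1)) := by positivity
    have htend : Filter.Tendsto (fun t : ℝ => a + t • d) (nhdsWithin 0 (Set.Ioi 0)) (nhds a) := by
      have : Filter.Tendsto (fun t : ℝ => a + t • d) (nhds 0) (nhds (a + (0 : ℝ) • d)) :=
        (by fun_prop : Continuous fun t : ℝ => a + t • d).tendsto 0
      rw [zero_smul, add_zero] at this
      exact this.mono_left nhdsWithin_le_nhds
    -- For such t the remainder costs at most tδ/2, and so does the ε-term of stationarity; together
    -- they give t(D + δ) ≥ 0.
    have hsmall : ∀ᶠ t : ℝ in nhdsWithin 0 (Set.Ioi 0),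
        t ∈ Set.Ioo 0 (min 1 (δ / (2 * (K * ‖d‖ ^ 2 + 1)))) :=
      Ioo_mem_nhdsGT (lt_min one_pos (by positivity))
    obtain ⟨t, ht, ht0, ht1⟩ := ((htend.eventually (h _ hε)).and hsmall).exists
    have ht1' : t < 1 := ht1.trans_le (min_le_left _ _)
    have ht2 : t * (2 * (K * ‖d‖ ^ 2 + 1)) ≤ δ := by
      have := (ht1.trans_le (min_le_right _ _)).le
      rwa [le_div_iff₀ (by positivity)] at this
    have hconv := (convexOn_convexPenalty (N := N) hτ).2 (Set.mem_univ (hankel N (a + d)))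
      (Set.mem_univ (hankel N a)) ht0.le (by linarith : 0 ≤ 1 - t) (by ring)
    have hcomb : t • hankel N (a + d) + (1 - t) • hankel N a = hankel N (a + t • d) := by
      have h1 : hankel N (t • d) = t • hankel N d := by
        ext; simp [hankel]
      rw [map_add, map_add, h1, smul_add, sub_smul, one_smul]; abel
    rw [hcomb] at hconv
    have hfrob : frobRe (hankel N (dualSeq μ f a)) (hankel N (t • d)) =
        t * frobRe (hankel N (dualSeq μ f a)) (hankel N d) := by
      rw [frobRe_hankel, frobRe_hankel, Finset.mul_sum]
      refine Finset.sum_congr rfl fun l _ => ?_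
      rw [← Complex.re_ofReal_mul]
      congr 1
      simp only [Pi.smul_apply, Complex.real_smul]
      ring
    have hobj := objective_sub μ f τ a (a + t • d)
    rw [add_sub_cancel_left, hfrob] at hobj
    rw [add_sub_cancel_left, norm_smul, Real.norm_eq_abs, abs_of_pos ht0] at ht
    have hq := (le_abs_self _).trans (hquad (t • d))
    simp only [Pi.add_apply, add_sub_cancel_left] at hobj
    rw [norm_smul, Real.norm_eq_abs, abs_of_pos ht0] at hq
    have hδ : δ / (2 * (‖d‖ + 1)) * ‖d‖ ≤ δ / 2 := by
      rw [div_mul_eq_mul_div, div_le_div_iff₀ (by positivity) (by norm_num)]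
      nlinarith [norm_nonneg d]
    simp only [smul_eq_mul] at hconv
    have hfin : 0 ≤ t * (D + δ) := by
      have e1 : t * (δ / (2 * (‖d‖ + 1)) * ‖d‖) ≤ t * (δ / 2) :=
        mul_le_mul_of_nonneg_left hδ ht0.le
      have e2 : t * (t * (2 * (K * ‖d‖ ^ 2 + 1))) ≤ t * δ := mul_le_mul_of_nonneg_left ht2 ht0.le
      rw [hD]
      nlinarith [sq_nonneg t]
    have := nonneg_of_mul_nonneg_right hfin ht0
    linarith
  · intro h ε hε
    -- Within this radius K‖x - a‖² ≤ ε‖x - a‖.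
    have hball : ∀ᶠ x in nhds a, x ∈ Metric.ball a (ε / (K + 1)) :=
      Metric.ball_mem_nhds a (by positivity)
    filter_upwards [hball] with x hx
    rw [mem_ball_iff_norm, lt_div_iff₀ (by positivity)] at hx
    have h1 := h (x - a)
    rw [add_sub_cancel] at h1
    have h2 := objective_sub μ f τ a x
    have h3 := (neg_abs_le _).trans' (neg_le_neg (hquad (x - a)))
    simp only [Pi.sub_apply] at h3
    nlinarith [norm_nonneg (x - a)]

/-! ### Convexity -/

theorem quadratic_convex_comb (m β s t : ℝ) (hst : s + t = 1) (x y z : ℂ) :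
    m * ‖s • x + t • y - z‖ ^ 2 - β * ‖s • x + t • y‖ ^ 2 =
      s * (m * ‖x - z‖ ^ 2 - β * ‖x‖ ^ 2) + t * (m * ‖y - z‖ ^ 2 - β * ‖y‖ ^ 2)
        - s * t * ((m - β) * ‖x - y‖ ^ 2) := by
  obtain rfl : t = 1 - s := by linarith
  simp only [← Complex.normSq_eq_norm_sq, Complex.normSq_apply, Complex.sub_re, Complex.sub_im,
    Complex.add_re, Complex.add_im, Complex.smul_re, Complex.smul_im, smul_eq_mul]
  ring

/-- Convexity of Φ ∘ Λ is combined with the exact convexity defect of the quadratic part; the sign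
of μ - β then decides the convexity of J. -/
theorem objective_convex_comb_le {N : ℕ} (μ : Fin (2 * N - 1) → ℝ) (f : Fin (2 * N - 1) → ℂ)
    {τ : ℝ} (hτ : 0 < τ) (x y : Fin (2 * N - 1) → ℂ) {s t : ℝ} (hs : 0 ≤ s) (ht : 0 ≤ t)
    (hst : s + t = 1) :
    objective μ f τ (s • x + t • y) ≤ s * objective μ f τ x + t * objective μ f τ y
      - s * t * ∑ l, (μ l - antidiagCount N l) * ‖x l - y l‖ ^ 2 := by
  have hconv := (convexOn_convexPenalty (N := N) hτ).2 (Set.mem_univ (hankel N x))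
    (Set.mem_univ (hankel N y)) hs ht hst
  have hcomb : s • hankel N x + t • hankel N y = hankel N (s • x + t • y) := by
    ext; simp [hankel]
  rw [hcomb] at hconv
  have hquad : ∑ l, (μ l * ‖(s • x + t • y) l - f l‖ ^ 2
        - antidiagCount N l * ‖(s • x + t • y) l‖ ^ 2) =
      s * ∑ l, (μ l * ‖x l - f l‖ ^ 2 - antidiagCount N l * ‖x l‖ ^ 2)
        + t * ∑ l, (μ l * ‖y l - f l‖ ^ 2 - antidiagCount N l * ‖y l‖ ^ 2)
        - s * t * ∑ l, (μ l - antidiagCount N l) * ‖x l - y l‖ ^ 2 := by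
    simp only [Finset.mul_sum]
    rw [← Finset.sum_add_distrib, ← Finset.sum_sub_distrib]
    exact Finset.sum_congr rfl fun l _ => quadratic_convex_comb _ _ s t hst _ _ _
  rw [objective_eq, objective_eq, objective_eq, hquad]
  simp only [smul_eq_mul] at hconv
  linarith

theorem convexOn_objective {N : ℕ} {μ : Fin (2 * N - 1) → ℝ} (f : Fin (2 * N - 1) → ℂ)
    {τ : ℝ} (hτ : 0 < τ) (h : ∀ l, antidiagCount N l ≤ μ l) :
    ConvexOn ℝ Set.univ (objective μ f τ) := by
  refine ⟨convex_univ, fun x _ y _ s t hs ht hst => ?_⟩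
  have h1 := objective_convex_comb_le μ f hτ x y hs ht hst
  have h2 : 0 ≤ ∑ l, (μ l - antidiagCount N l) * ‖x l - y l‖ ^ 2 :=
    Finset.sum_nonneg fun l _ => mul_nonneg (sub_nonneg.2 (h l)) (by positivity)
  have := mul_nonneg (mul_nonneg hs ht) h2
  simp only [smul_eq_mul]
  linarith

theorem strictConvexOn_objective {N : ℕ} {μ : Fin (2 * N - 1) → ℝ} (f : Fin (2 * N - 1) → ℂ)
    {τ : ℝ} (hτ : 0 < τ) (h : ∀ l, antidiagCount N l < μ l) :
    StrictConvexOn ℝ Set.univ (objective μ f τ) := by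
  refine ⟨convex_univ, fun x _ y _ hxy s t hs ht hst => ?_⟩
  have h1 := objective_convex_comb_le μ f hτ x y hs.le ht.le hst
  have h2 : 0 < ∑ l, (μ l - antidiagCount N l) * ‖x l - y l‖ ^ 2 := by
    obtain ⟨l, hl⟩ := Function.ne_iff.1 hxy
    refine Finset.sum_pos' (fun l _ => mul_nonneg (sub_nonneg.2 (h l).le) (by positivity))
      ⟨l, Finset.mem_univ l, mul_pos (sub_pos.2 (h l)) ?_⟩
    have := norm_pos_iff.2 (sub_ne_zero.2 hl)
    positivity
  have := mul_pos (mul_pos hs ht) h2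
  simp only [smul_eq_mul]
  linarith

/-! ### Fixed points and stationary points -/

/-- The subdifferential of `convexPenalty τ ∘ hankel N`. -/
theorem exists_isHalfSubgradient_iff {N : ℕ} {τ : ℝ} (hτ : 0 < τ) (a g : Fin (2 * N - 1) → ℂ) :
    (∃ W, projHankel W = hankel N g ∧ IsHalfSubgradient τ (hankel N a) W) ↔
      ∀ d, convexPenalty τ (hankel N a) + 2 * frobRe (hankel N g) (hankel N d) ≤
        convexPenalty τ (hankel N (a + d)) := by
  constructor
  · rintro ⟨W, hW, h⟩ d
    have := h (hankel N (a + d))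
    rwa [map_add, add_sub_cancel_left, (projHankel_eq_hankel_iff W g).1 hW, ← map_add] at this
  · intro h
    -- Any norm would do here: it serves only to supply the topology for the separation argument.
    let _ : NormedAddCommGroup (Matrix (Fin N) (Fin N) ℂ) := Matrix.normedAddCommGroup
    let _ : NormedSpace ℝ (Matrix (Fin N) (Fin N) ℂ) := Matrix.normedSpace
    let G : Matrix (Fin N) (Fin N) ℂ →ₗ[ℝ] ℝ :=
      { toFun := fun X => 2 * frobRe (hankel N g) X
        map_add' := fun X Y => by rw [frobRe_add_right]; ring
        map_smul' := fun c X => by simp [frobRe]; ring }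
    obtain ⟨L, hL₁, hL₂⟩ := exists_subgradient_extension
      (convexOn_convexPenalty (N := N) hτ) ((hankelSpace N).restrictScalars ℝ) (hankel N a) G (by
        rintro _ ⟨d, rfl⟩
        rw [← map_add]
        exact h d)
    obtain ⟨W, hW⟩ := exists_frobRe_eq ((2 : ℝ)⁻¹ • L)
    have hLW : ∀ X, L X = 2 * frobRe W X := fun X => by
      rw [← hW]; simp
    refine ⟨W, (projHankel_eq_hankel_iff W g).2 fun b => ?_, fun B => ?_⟩
    · have h1 := hL₁ (hankel N b) ⟨b, rfl⟩
      rw [hLW] at h1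
      have h2 : G (hankel N b) = 2 * frobRe (hankel N g) (hankel N b) := rfl
      linarith
    · have := hL₂ (B - hankel N a)
      rwa [hLW, add_sub_cancel] at this

end

end HankelApprox

theorem corollary6p1 (N : ℕ) (hN : 1 ≤ N) (τ q : ℝ) (hτ : 0 < τ) (hq : 1 < q)
    (μ : Fin (2 * N - 1) → ℝ) (hμ : ∀ l, 0 < μ l) (f : Fin (2 * N - 1) → ℂ)
    (hqμ : ∀ l, μ l / HankelApprox.antidiagCount N l ≤ q) :
    (∀ A : Matrix (Fin N) (Fin N) ℂ,
      (∃ W : Matrix (Fin N) (Fin N) ℂ,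
        Function.IsFixedPt (HankelApprox.weightedMap μ f τ q) (W, A)) ↔
      ∃ a : Fin (2 * N - 1) → ℂ, A = HankelApprox.hankel N a ∧
        HankelApprox.IsStationary (HankelApprox.objective μ f τ) a) ∧
    ((∀ l, 1 ≤ μ l / HankelApprox.antidiagCount N l) →
      ConvexOn ℝ Set.univ (HankelApprox.objective μ f τ)) ∧
    ((∀ l, 1 < μ l / HankelApprox.antidiagCount N l) →
      StrictConvexOn ℝ Set.univ (HankelApprox.objective μ f τ)) := by
  refine ⟨fun A => ?_, fun h => ?_, fun h => ?_⟩
  · simp only [HankelApprox.isFixedPt_weightedMap_iff μ f τ hq,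
      HankelApprox.isStationary_objective_iff μ f hτ,
      ← HankelApprox.exists_isHalfSubgradient_iff hτ,
      HankelApprox.isHalfSubgradient_iff hτ hq]
    -- Both sides now impose the same conditions on a and W; only the order of the quantifiers
    -- differs.
    constructor
    · rintro ⟨W, a, rfl, h⟩
      exact ⟨a, rfl, W, h⟩
    · rintro ⟨a, rfl, W, h⟩
      exact ⟨W, a, rfl, h⟩
  · exact HankelApprox.convexOn_objective f hτ fun l =>
      (one_le_div (HankelApprox.antidiagCount_pos N l)).1 (h l)
  · exact HankelApprox.strictConvexOn_objective f hτ fun l =>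
      (one_lt_div (HankelApprox.antidiagCount_pos N l)).1 (h l)
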